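/- Let $p$ be a prime, $k$ a perfect field of characteristic $p$, $d\ge 1$, $A=k[t_1,\dots,t_d]$, and for $n\ge 1$ let $W_n$ denote $p$-typical Witt vectors of length $n$ and $A_n=W_n(k)[t_1,\dots,t_d]$. Let $\tilde w_{n-1}\colon W_n(A)\to A_n$ be the map $(f_1,\dots,f_n)\mapsto \sum_{i=1}^{n}p^{i-1}\tilde f_i^{\,p^{n-i}}$, where $\tilde f_i\in A_n$ is any lift of $f_i\in A$ (the value does not depend on the lifts). For $1\le j\le d$ and $r\ge 0$ let $\partial_{j,n}^{[r]}=\frac1{r!}\left(\frac{\partial}{\partial t_j}\right)^r\colon A_n\to A_n$ be the $W_n(k)$-linear operator $t^{e}\mapsto\binom{e_j}{r}t_j^{-r}t^{e}$ (which is $0$ if $e_j<r$). There is a unique $W_n(k)$-linear differential operator (in the sense of Grothendieck) on $W_n(A)$, still denoted $\partial_{j,n}^{[r]}\colon W_n(A)\to W_n(A)$, with $\tilde w_{n-1}\circ\partial_{j,n}^{[r]}=\partial_{j,n}^{[r]}\circ\tilde w_{n-1}$, and it has order at most $r$. Let $R\colon W_{n+1}(A)\to W_n(A)$ be the restriction $(a_1,\dots,a_{n+1})\mapsto(a_1,\dots,a_n)$,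 $V\colon W_n(A)\to W_{n+1}(A)$ the Verschiebung $(a_1,\dots,a_n)\mapsto(0,a_1,\dots,a_n)$, $\Phi_A\colon W_{n+1}(A)\to W_{n+1}(A)$ the map $(a_1,\dots,a_{n+1})\mapsto(a_1^p,\dots,a_{n+1}^p)$ induced by the Frobenius of $A$, and $V^iW_{n+1}(A)\subset W_{n+1}(A)$ the set of Witt vectors whose first $i$ coordinates vanish, i.e. the image of $V^i$. Then for all $n\ge 1$, $1\le j\le d$ and $r\ge 0$: \begin{align*} \partial_{j,n}^{[r/p]}\circ R&=R\circ\partial_{j,n+1}^{[r]},\\ \partial_{j,n+1}^{[r]}\circ\Phi_A&=\Phi_A\circ\partial_{j,n+1}^{[r/p]},\\ \partial_{j,n+1}^{[r]}\circ V&=V\circ\partial_{j,n}^{[r]},\\ \partial_{j,n+1}^{[r]}\bigl(V^iW_{n+1}(A)\bigr)&\subset V^iW_{n+1}(A)\qquad\text{for all }0\le i<n+1, \end{align*} where $\partial_{j,n}^{[r/p]}$ and $\partial_{j,n+1}^{[r/p]}$ are understood to be $0$ if $p\nmid r$. The second and fourth relations also hold for $n=0$. For $\mathbf r=(r_1,\dots,r_d)\in\mathbb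 N^d$ put $\partial_n^{[\mathbf r]}=\partial_{1,n}^{[r_1]}\circ\cdots\circ\partial_{d,n}^{[r_d]}$ on $W_n(A)$ and $\partial_n^{[\mathbf r/p]}=\partial_{1,n}^{[r_1/p]}\circ\cdots\circ\partial_{d,n}^{[r_d/p]}$ (so it is $0$ if $p\nmid r_j$ for some $j$). Then the same four relations hold with $\partial_{j}^{[r]}$, $\partial_j^{[r/p]}$ replaced by $\partial^{[\mathbf r]}$, $\partial^{[\mathbf r/p]}$. -/

import Mathlib

noncomputable section

namespace WittDiff

section TruncatedMaps

variable {p : ℕ} [Fact p.Prime]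

/-- The ring homomorphism `W_n(f) : W_n(R) → W_n(S)` induced by `f : R → S`; it acts
coordinatewise by `f`. -/
def truncMap (n : ℕ) {R S : Type*} [CommRing R] [CommRing S] (f : R →+* S) :
    TruncatedWittVector p n R →+* TruncatedWittVector p n S :=
  have key : ∀ a : WittVector p R,
      TruncatedWittVector.mk p (fun i : Fin n => f ((WittVector.truncate n a).coeff i)) =
        WittVector.truncate n (WittVector.map f a) := fun a => by
    ext i
    simp [WittVector.coeff_truncate, WittVector.map_coeff]
  { toFun := fun x => TruncatedWittVector.mk p fun i => f (x.coeff i)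
    map_one' := by
      rw [← map_one (WittVector.truncate (p := p) (R := R) n), key, map_one, map_one]
    map_zero' := by
      rw [← map_zero (WittVector.truncate (p := p) (R := R) n), key, map_zero, map_zero]
    map_mul' := fun x y => by
      obtain ⟨a, rfl⟩ := WittVector.truncate_surjective p n R x
      obtain ⟨b, rfl⟩ := WittVector.truncate_surjective p n R y
      rw [← map_mul, key, key, key, map_mul, map_mul]
    map_add' := fun x y => by
      obtain ⟨a, rfl⟩ := WittVector.truncate_surjective p n R x
      obtain ⟨b, rfl⟩ := WittVector.truncate_surjective p n R y
      rw [← map_add, key, key, key, map_add, map_add] }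

/-- The restriction `R : W_{n+1}(S) → W_n(S)`, dropping the last coordinate. -/
def res (n : ℕ) {S : Type*} [CommRing S] :
    TruncatedWittVector p (n + 1) S →+* TruncatedWittVector p n S :=
  TruncatedWittVector.truncate (Nat.le_succ n)

/-- The Verschiebung `V : W_n(S) → W_{n+1}(S)`, `(a₁, …, aₙ) ↦ (0, a₁, …, aₙ)`. -/
def ver (n : ℕ) {S : Type*} [CommRing S] (x : TruncatedWittVector p n S) :
    TruncatedWittVector p (n + 1) S :=
  TruncatedWittVector.mk p (Fin.cons 0 fun i : Fin n => x.coeff i)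

/-- `V^i W_{n+1}(S)`, the image of the `i`-fold iterate of the endomorphism
`(a₁, …, aₙ₊₁) ↦ (0, a₁, …, aₙ)` of `W_{n+1}(S)`. -/
def verFil (p : ℕ) [Fact p.Prime] (n i : ℕ) (S : Type*) [CommRing S] :
    Set (TruncatedWittVector p (n + 1) S) :=
  Set.range (fun x : TruncatedWittVector p (n + 1) S => ver n (res n x))^[i]

end TruncatedMaps

section DifferentialOperators

/-- `δ` is an `R`-linear differential operator on `B` of order `≤ m`, in the sense of
Grothendieck. -/
def IsDiffOp {R B : Type*} [CommRing R] [CommRing B] [Algebra R B] :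
    ℕ → Module.End R B → Prop
  | 0, δ => ∀ b : B, δ * LinearMap.mulLeft R b - LinearMap.mulLeft R b * δ = 0
  | m + 1, δ => ∀ b : B, IsDiffOp m (δ * LinearMap.mulLeft R b - LinearMap.mulLeft R b * δ)

/-- The `r`-th divided power `∂_j^{[r]} = (1/r!) (∂/∂t_j)^r` of the partial derivative on a
polynomial ring: `t^e ↦ (e_j choose r) t^(e - r·1_j)` (which is `0` if `e_j < r`). -/
def hasse (R : Type*) [CommRing R] {d : ℕ} (j : Fin d) (r : ℕ) :
    Module.End R (MvPolynomial (Fin d) R) :=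
  (MvPolynomial.basisMonomials (Fin d) R).constr R fun e =>
    MvPolynomial.monomial (e - Finsupp.single j r) ((e j).choose r : R)

end DifferentialOperators

section Ghost

variable (p : ℕ) [Fact p.Prime] (k : Type*) [Field k]

/-- A lift to `A_n = W_n(k)[t₁,…,t_d]` of `f ∈ A = k[t₁,…,t_d]`, obtained by taking
Teichmüller representatives of the coefficients. -/
def polyLift (n : ℕ) {d : ℕ} (f : MvPolynomial (Fin d) k) :
    MvPolynomial (Fin d) (TruncatedWittVector p n k) :=
  ∑ e ∈ f.support, MvPolynomial.monomial e
    (WittVector.truncate n (WittVector.teichmuller p (f.coeff e)))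

/-- The map `W_n(A) → A_n` through which the top ghost component `W_n(A_n) → A_n` factors:
`(f₁, …, fₙ) ↦ ∑ p^(i-1) g_i^(p^(n-i))`, where `g_i ∈ A_n` is a lift of `f_i ∈ A`. The value does
not depend on the lifts, see `ghostTilde_eq`. -/
def ghostTilde (n : ℕ) {d : ℕ} (x : TruncatedWittVector p n (MvPolynomial (Fin d) k)) :
    MvPolynomial (Fin d) (TruncatedWittVector p n k) :=
  ∑ i : Fin n, (p : MvPolynomial (Fin d) (TruncatedWittVector p n k)) ^ (i : ℕ) *
    polyLift p k n (x.coeff i) ^ p ^ (n - 1 - (i : ℕ))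

theorem truncated_p_pow [CharP k p] (n : ℕ) : (p : TruncatedWittVector p n k) ^ n = 0 := by
  have h : (p : TruncatedWittVector p n k) ^ n =
      WittVector.truncate n ((p : WittVector p k) ^ n) := by simp
  rw [h]
  ext i
  rw [WittVector.coeff_truncate, TruncatedWittVector.coeff_zero]
  exact WittVector.coeff_p_pow_eq_zero p k (ne_of_lt i.2)

theorem truncated_p_dvd [CharP k p] [PerfectRing k p] (n : ℕ)
    (x : TruncatedWittVector p (n + 1) k) (hx : x.coeff 0 = 0) :
    (p : TruncatedWittVector p (n + 1) k) ∣ x := by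
  obtain ⟨y, rfl⟩ := WittVector.truncate_surjective p (n + 1) k x
  have hy : y.coeff 0 = 0 := by simpa [WittVector.coeff_truncate] using hx
  have h1 : WittVector.verschiebung (y.shift 1) = y := by
    have := WittVector.verschiebung_shift y 0 (by intro i hi; interval_cases i; exact hy)
    simpa [WittVector.shift] using this
  obtain ⟨z, hz⟩ := (WittVector.frobeniusEquiv p k).surjective (y.shift 1)
  have h2 : y = z * p := by
    rw [← h1, ← hz]
    exact WittVector.verschiebung_frobenius z
  exact ⟨WittVector.truncate (n + 1) z, by rw [h2]; simp [mul_comm]⟩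

/-- `ghostTilde` may be computed with arbitrary lifts `g i` of the coordinates. -/
theorem ghostTilde_eq [CharP k p] [PerfectRing k p] (n : ℕ) {d : ℕ}
    (x : TruncatedWittVector p (n + 1) (MvPolynomial (Fin d) k))
    (g : Fin (n + 1) → MvPolynomial (Fin d) (TruncatedWittVector p (n + 1) k))
    (hg : ∀ i e, ((g i).coeff e).coeff 0 = (x.coeff i).coeff e) :
    ghostTilde p k (n + 1) x =
      ∑ i : Fin (n + 1), (p : MvPolynomial (Fin d) (TruncatedWittVector p (n + 1) k)) ^ (i : ℕ) *
        g i ^ p ^ (n - (i : ℕ)) := by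
  have hsub : ∀ a b : TruncatedWittVector p (n + 1) k, a.coeff 0 = b.coeff 0 →
      (a - b).coeff 0 = 0 := by
    intro a b hab
    obtain ⟨a, rfl⟩ := WittVector.truncate_surjective p (n + 1) k a
    obtain ⟨b, rfl⟩ := WittVector.truncate_surjective p (n + 1) k b
    rw [WittVector.coeff_truncate, WittVector.coeff_truncate] at hab
    rw [← map_sub, WittVector.coeff_truncate]
    have := map_sub (WittVector.constantCoeff : WittVector p k →+* k) a b
    simp only [WittVector.constantCoeff_apply] at this
    simp only [Fin.val_zero] at hab ⊢
    rw [this, hab, sub_self]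
  have hp : (p : MvPolynomial (Fin d) (TruncatedWittVector p (n + 1) k)) ^ (n + 1) = 0 := by
    have := congrArg (MvPolynomial.C (σ := Fin d)) (truncated_p_pow p k (n + 1))
    simpa using this
  refine Finset.sum_congr rfl fun i _ => ?_
  have hL : ∀ e, ((polyLift p k (n + 1) (x.coeff i)).coeff e).coeff 0 = (x.coeff i).coeff e := by
    intro e
    unfold polyLift
    rw [MvPolynomial.coeff_sum]
    simp only [MvPolynomial.coeff_monomial]
    rw [Finset.sum_ite_eq']
    split_ifs with h
    · simp [WittVector.coeff_truncate]
    · rw [TruncatedWittVector.coeff_zero]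
      exact (MvPolynomial.notMem_support_iff.mp h).symm
  have hdvd : (p : MvPolynomial (Fin d) (TruncatedWittVector p (n + 1) k)) ∣
      polyLift p k (n + 1) (x.coeff i) - g i := by
    have : (p : MvPolynomial (Fin d) (TruncatedWittVector p (n + 1) k)) =
        MvPolynomial.C (p : TruncatedWittVector p (n + 1) k) := by simp
    rw [this, MvPolynomial.C_dvd_iff_dvd_coeff]
    intro e
    apply truncated_p_dvd
    rw [MvPolynomial.coeff_sub]
    exact hsub _ _ ((hL e).trans (hg i e).symm)
  obtain ⟨c, hc⟩ := dvd_sub_pow_of_dvd_sub hdvd (n - (i : ℕ))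
  rw [← sub_eq_zero, ← mul_sub, Nat.add_sub_cancel, hc, ← mul_assoc, ← pow_add,
    show (i : ℕ) + (n - (i : ℕ) + 1) = n + 1 by omega, hp, zero_mul]

end Ghost

section Operators

variable (p : ℕ) [Fact p.Prime] (k : Type*) [Field k]

/-- The canonical `W_n(k)`-algebra structure on `W_n(k[t₁,…,t_d])`. -/
instance truncAlgebra (n d : ℕ) :
    Algebra (TruncatedWittVector p n k) (TruncatedWittVector p n (MvPolynomial (Fin d) k)) :=
  (truncMap n (algebraMap k (MvPolynomial (Fin d) k))).toAlgebra

/-- `δ` is the restriction to `W_n(A)` of the operator `D` on `A_n`: a `W_n(k)`-linear differential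
operator on `W_n(A)` (of some order) which is compatible with `D` under `ghostTilde`. -/
def IsRestriction {n d : ℕ}
    (D : Module.End (TruncatedWittVector p n k)
      (MvPolynomial (Fin d) (TruncatedWittVector p n k)))
    (δ : Module.End (TruncatedWittVector p n k)
      (TruncatedWittVector p n (MvPolynomial (Fin d) k))) : Prop :=
  (∃ m, IsDiffOp m δ) ∧ ∀ x, ghostTilde p k n (δ x) = D (ghostTilde p k n x)

open Classical in
/-- The restriction of `D` to `W_n(A)` (and `0` if there is none). -/
def restriction {n d : ℕ}
    (D : Module.End (TruncatedWittVector p n k)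
      (MvPolynomial (Fin d) (TruncatedWittVector p n k))) :
    Module.End (TruncatedWittVector p n k)
      (TruncatedWittVector p n (MvPolynomial (Fin d) k)) :=
  if h : ∃ δ, IsRestriction p k D δ then h.choose else 0

/-- The Witt differential operator `∂_{j,n}^{[r]} : W_n(A) → W_n(A)`. -/
def wittDiffOp (n : ℕ) {d : ℕ} (j : Fin d) (r : ℕ) :
    Module.End (TruncatedWittVector p n k)
      (TruncatedWittVector p n (MvPolynomial (Fin d) k)) :=
  restriction p k (hasse (TruncatedWittVector p n k) j r)

/-- `∂_{j,n}^{[r/p]}`, meant to be `0` if `p ∤ r`. -/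
def wittDiffOpDiv (n : ℕ) {d : ℕ} (j : Fin d) (r : ℕ) :
    Module.End (TruncatedWittVector p n k)
      (TruncatedWittVector p n (MvPolynomial (Fin d) k)) :=
  if p ∣ r then wittDiffOp p k n j (r / p) else 0

/-- `∂_n^{[𝐫]} = ∂_{1,n}^{[r₁]} ∘ ⋯ ∘ ∂_{d,n}^{[r_d]}` on `W_n(A)`. -/
def wittDiffOpMulti (n : ℕ) {d : ℕ} (r : Fin d → ℕ) :
    Module.End (TruncatedWittVector p n k)
      (TruncatedWittVector p n (MvPolynomial (Fin d) k)) :=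
  (List.ofFn fun j => wittDiffOp p k n j (r j)).prod

/-- `∂_n^{[𝐫/p]} = ∂_{1,n}^{[r₁/p]} ∘ ⋯ ∘ ∂_{d,n}^{[r_d/p]}`; it is `0` if `p ∤ r_j` for some `j`. -/
def wittDiffOpMultiDiv (n : ℕ) {d : ℕ} (r : Fin d → ℕ) :
    Module.End (TruncatedWittVector p n k)
      (TruncatedWittVector p n (MvPolynomial (Fin d) k)) :=
  (List.ofFn fun j => wittDiffOpDiv p k n j (r j)).prod

/-- `Φ_A : W_n(A) → W_n(A)`, induced by the Frobenius `f ↦ f^p` of `A = k[t₁,…,t_d]`. -/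
def frobA [CharP k p] (n d : ℕ) :
    TruncatedWittVector p n (MvPolynomial (Fin d) k) →+*
      TruncatedWittVector p n (MvPolynomial (Fin d) k) :=
  truncMap n (frobenius (MvPolynomial (Fin d) k) p)

end Operators

end WittDiff

end

/-! Everything is transported along the ghost map `W_n(A) → A_n`. It is an injective ring
homomorphism (`ghostHom_injective`), and its image consists of the polynomials `∑ a_e t^e` with
`p^(n-1) ∣ e_j a_e` for all `e` and `j` (`isAdmissible_ghostTilde`, `IsAdmissible.mem_range`). The
divided-power derivatives preserve these congruences (`IsAdmissible.hasse`), so they restrict to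
`W_n(A)`; injectivity gives uniqueness and the bound on the order.

The relations become identities in polynomial rings. Let `F` be the lift of Frobenius to `A_n` with
`t_j ↦ t_j^p`. The ghost map turns `Φ_A` into `F`. It does not commute with `R`: ghost after `R`
agrees with the reduction of ghost only after applying `F` (`frobLift_ghostHom_res`). Both relations
involving `r/p` thus reduce to `∂^[r] F = F ∂^[r/p]` on admissible polynomials (`hasse_frobLift`),
which rests on `(1 + T)^(p^(v+1) u) ≡ (1 + T^p)^(p^v u)` modulo `p^(v+1)`. The Verschiebung becomes
multiplication by `p` on lifts, which commutes with the linear operator `∂^[r]`. Stability of the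
`V`-filtration follows formally from the relations for `R` and `V`. -/

namespace WittDiff

/-! ### Formal properties of Grothendieck differential operators -/

section DifferentialOperators

variable {R B : Type*} [CommRing R] [CommRing B] [Algebra R B]

theorem isDiffOp_zero (m : ℕ) : IsDiffOp m (0 : Module.End R B) := by
  induction m with
  | zero => intro b; simp
  | succ m ih => intro b; simpa using ih

theorem IsDiffOp.add {m : ℕ} {δ ε : Module.End R B} (hδ : IsDiffOp m δ) (hε : IsDiffOp m ε) :
    IsDiffOp m (δ + ε) := by
  have key : ∀ (δ ε : Module.End R B) (b : B),
      (δ + ε) * LinearMap.mulLeft R b - LinearMap.mulLeft R b * (δ + ε) =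
        (δ * LinearMap.mulLeft R b - LinearMap.mulLeft R b * δ) +
          (ε * LinearMap.mulLeft R b - LinearMap.mulLeft R b * ε) := fun δ ε b => by noncomm_ring
  induction m generalizing δ ε with
  | zero => intro b; rw [key, hδ b, hε b, add_zero]
  | succ m ih => intro b; rw [key]; exact ih (hδ b) (hε b)

theorem isDiffOp_sum {ι : Type*} {m : ℕ} (s : Finset ι) {δ : ι → Module.End R B}
    (h : ∀ i ∈ s, IsDiffOp m (δ i)) : IsDiffOp m (∑ i ∈ s, δ i) :=
  Finset.sum_induction _ _ (fun _ _ => IsDiffOp.add) (isDiffOp_zero m) h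

theorem IsDiffOp.mulLeft_mul {m : ℕ} {δ : Module.End R B} (h : IsDiffOp m δ) (a : B) :
    IsDiffOp m (LinearMap.mulLeft R a * δ) := by
  have key : ∀ (δ : Module.End R B) (b : B),
      LinearMap.mulLeft R a * δ * LinearMap.mulLeft R b -
        LinearMap.mulLeft R b * (LinearMap.mulLeft R a * δ) =
      LinearMap.mulLeft R a * (δ * LinearMap.mulLeft R b - LinearMap.mulLeft R b * δ) :=
    fun δ b => by
      ext x
      simp only [LinearMap.sub_apply, Module.End.mul_apply, LinearMap.mulLeft_apply]
      ring
  induction m generalizing δ with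
  | zero => intro b; rw [key, h b, mul_zero]
  | succ m ih => intro b; rw [key]; exact ih (h b)

theorem IsDiffOp.succ {m : ℕ} {δ : Module.End R B} (h : IsDiffOp m δ) : IsDiffOp (m + 1) δ := by
  induction m generalizing δ with
  | zero => intro b; rw [h b]; exact isDiffOp_zero 0
  | succ m ih => intro b; exact ih (h b)

theorem IsDiffOp.mono {m n : ℕ} (hmn : m ≤ n) {δ : Module.End R B} (h : IsDiffOp m δ) :
    IsDiffOp n δ := by
  induction hmn with
  | refl => exact h
  | step _ ih => exact ih.succ

/-- Differential operators restrict along injective ring homomorphisms. -/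
theorem IsDiffOp.of_injective {S C : Type*} [CommRing S] [CommRing C] [Algebra S C]
    {w : B →+* C} (hw : Function.Injective w) {m : ℕ} {D : Module.End S C} {δ : Module.End R B}
    (h : ∀ x, w (δ x) = D (w x)) (hD : IsDiffOp m D) : IsDiffOp m δ := by
  have key : ∀ {D : Module.End S C} {δ : Module.End R B}, (∀ x, w (δ x) = D (w x)) → ∀ b x,
      w ((δ * LinearMap.mulLeft R b - LinearMap.mulLeft R b * δ) x) =
        (D * LinearMap.mulLeft S (w b) - LinearMap.mulLeft S (w b) * D) (w x) := by
    intro D δ h b x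
    simp [h]
  induction m generalizing D δ with
  | zero =>
    intro b
    ext x
    apply hw
    rw [key h b x, hD (w b), LinearMap.zero_apply, LinearMap.zero_apply, map_zero]
  | succ m ih => intro b; exact ih (key h b) (hD (w b))

end DifferentialOperators

/-! ### Divided-power derivatives on polynomial rings -/

section Hasse

open MvPolynomial

variable {R : Type*} [CommRing R] {d : ℕ}

theorem hasse_monomial (j : Fin d) (r : ℕ) (e : Fin d →₀ ℕ) (a : R) :
    hasse R j r (monomial e a) =
      monomial (e - Finsupp.single j r) (((e j).choose r : R) * a) := by
  have h : monomial e a = a • basisMonomials (Fin d) R e := by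
    rw [coe_basisMonomials, smul_monomial, smul_eq_mul, mul_one]
  rw [h, map_smul, hasse, Module.Basis.constr_basis, smul_monomial, smul_eq_mul, mul_comm]

theorem coeff_hasse (j : Fin d) (r : ℕ) (f : MvPolynomial (Fin d) R) (e : Fin d →₀ ℕ) :
    coeff e (hasse R j r f) =
      ((e j + r).choose r : R) * coeff (e + Finsupp.single j r) f := by
  induction f using MvPolynomial.induction_on' with
  | add f g hf hg => rw [map_add, coeff_add, hf, hg, coeff_add, mul_add]
  | monomial u a =>
    rw [hasse_monomial, coeff_monomial, coeff_monomial]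
    by_cases hu : u = e + Finsupp.single j r
    · subst hu
      simp
    · rw [if_neg hu, mul_zero]
      split_ifs with h
      · have hlt : u j < r := by
          by_contra hle
          apply hu
          rw [← h, tsub_add_cancel_of_le]
          simpa using not_lt.mp hle
        rw [Nat.choose_eq_zero_of_lt hlt, Nat.cast_zero, zero_mul]
      · rfl

theorem hasse_zero (j : Fin d) : hasse R j 0 = 1 := by
  refine LinearMap.ext fun f => ?_
  ext e
  simp [coeff_hasse]

/-- On monomials this is Vandermonde's identity for binomial coefficients. -/
theorem hasse_mul (j : Fin d) (r : ℕ) (f g : MvPolynomial (Fin d) R) :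
    hasse R j r (f * g) =
      ∑ s ∈ Finset.HasAntidiagonal.antidiagonal r, hasse R j s.1 f * hasse R j s.2 g := by
  induction f using MvPolynomial.induction_on' with
  | add f₁ f₂ h₁ h₂ => simp only [add_mul, map_add, h₁, h₂, Finset.sum_add_distrib]
  | monomial u a =>
    induction g using MvPolynomial.induction_on' with
    | add f₁ f₂ h₁ h₂ => simp only [mul_add, map_add, h₁, h₂, Finset.sum_add_distrib]
    | monomial v b =>
      have h : ∀ s ∈ Finset.HasAntidiagonal.antidiagonal r,
          hasse R j s.1 (monomial u a) * hasse R j s.2 (monomial v b) =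
            monomial (u + v - Finsupp.single j r)
              ((((u j).choose s.1 * (v j).choose s.2 : ℕ) : R) * (a * b)) := by
        intro s hs
        rw [Finset.HasAntidiagonal.mem_antidiagonal] at hs
        rw [hasse_monomial, hasse_monomial, monomial_mul]
        -- If a subtraction of exponents truncates, the corresponding binomial coefficient vanishes
        -- and both sides are zero; otherwise the exponents add up.
        by_cases hu : u j < s.1
        · simp [Nat.choose_eq_zero_of_lt hu]
        by_cases hv : v j < s.2
        · simp [Nat.choose_eq_zero_of_lt hv]
        refine congrArg₂ (fun e c => monomial e c) ?_ ?_
        · ext i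
          by_cases hi : j = i
          · subst hi
            simp only [Finsupp.coe_add, Finsupp.coe_tsub, Pi.add_apply, Pi.sub_apply,
              Finsupp.single_eq_same]
            omega
          · simp [Finsupp.single_eq_of_ne' hi]
        · push_cast
          ring
      rw [Finset.sum_congr rfl h, monomial_mul, hasse_monomial, ← map_sum, ← Finset.sum_mul,
        Finsupp.add_apply, Nat.add_choose_eq, Nat.cast_sum]

/-- By the Leibniz rule, the commutator of `∂^[r+1]` with multiplication by `b` is `∑ (∂^[s+1] b)
∂^[r-s]` over `0 ≤ s ≤ r`: the term with `b` undifferentiated cancels, and only operators of order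
at most `r` remain. -/
theorem isDiffOp_hasse (j : Fin d) (r : ℕ) : IsDiffOp r (hasse R j r) := by
  induction r using Nat.strong_induction_on with
  | _ r ih =>
    cases r with
    | zero => intro b; rw [hasse_zero, one_mul, mul_one, sub_self]
    | succ r =>
      intro b
      have h : hasse R j (r + 1) * LinearMap.mulLeft R b -
          LinearMap.mulLeft R b * hasse R j (r + 1) =
          ∑ s ∈ Finset.HasAntidiagonal.antidiagonal r, LinearMap.mulLeft R (hasse R j (s.1 + 1) b) *
            hasse R j s.2 := by
        refine LinearMap.ext fun f => ?_
        rw [LinearMap.sub_apply, Module.End.mul_apply, LinearMap.mulLeft_apply, hasse_mul,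
          Finset.Nat.antidiagonal_succ, Finset.sum_cons, Finset.sum_map]
        simp [hasse_zero, LinearMap.sum_apply]
      rw [h]
      refine isDiffOp_sum _ fun s hs => IsDiffOp.mulLeft_mul ?_ _
      rw [Finset.HasAntidiagonal.mem_antidiagonal] at hs
      exact (ih s.2 (by omega)).mono (by omega)

theorem map_hasse {S : Type*} [CommRing S] (f : R →+* S) (j : Fin d) (r : ℕ)
    (g : MvPolynomial (Fin d) R) : map f (hasse R j r g) = hasse S j r (map f g) := by
  ext e
  simp [coeff_hasse, coeff_map]

end Hasse

/-! ### A congruence between binomial coefficients -/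

section Binomial

/-- `(1 + T)^(p^(v+1) u) ≡ (1 + T^p)^(p^v u)` modulo `p^(v+1)`, coefficientwise. -/
theorem pow_dvd_choose_mul_sub {p : ℕ} (hp : p.Prime) (v u r : ℕ) :
    (p : ℤ) ^ (v + 1) ∣ ((p * (p ^ v * u)).choose r : ℤ) -
      if p ∣ r then ((p ^ v * u).choose (r / p) : ℤ) else 0 := by
  have := Fact.mk hp
  open Polynomial in
  have h0 : (p : ℤ[X]) ∣ (X + 1) ^ p - expand ℤ p (X + 1) := by
    have hC : (p : ℤ[X]) = C (p : ℤ) := by simp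
    rw [hC, C_dvd_iff_dvd_coeff]
    intro i
    have hmap : ((X + 1) ^ p - expand ℤ p (X + 1)).map (Int.castRingHom (ZMod p)) = 0 := by
      simp [add_pow_char]
    have := congrArg (fun q => coeff q i) hmap
    simp only [coeff_map, coeff_zero, eq_intCast] at this
    exact (ZMod.intCast_zmod_eq_zero_iff_dvd _ _).mp this
  -- Raising a congruence modulo `p` to the power `p^v` improves it to one modulo `p^(v+1)`; the
  -- further power `u` preserves it.
  open Polynomial in
  have h1 := ((dvd_sub_pow_of_dvd_sub h0 v).trans (sub_dvd_pow_sub_pow _ _ u))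
  open Polynomial in
  rw [← pow_mul, ← pow_mul, ← pow_mul, ← map_pow,
    show ((p : ℤ[X]) ^ (v + 1)) = C ((p : ℤ) ^ (v + 1)) by simp, C_dvd_iff_dvd_coeff] at h1
  have h2 := h1 r
  rw [Polynomial.coeff_sub, Polynomial.coeff_X_add_one_pow, Polynomial.coeff_expand hp.pos,
    Polynomial.coeff_X_add_one_pow] at h2
  simpa using h2

end Binomial

open MvPolynomial

/-! ### Powers of `p` in `W_n(k)` -/

section TruncatedWittVectors

theorem subsingleton_truncated_zero (p : ℕ) (S : Type*) :
    Subsingleton (TruncatedWittVector p 0 S) :=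
  ⟨fun _ _ => TruncatedWittVector.ext fun i => i.elim0⟩

variable (p : ℕ) [Fact p.Prime]

variable {p} in
theorem coeff_truncMap {n : ℕ} {R S : Type*} [CommRing R] [CommRing S] (f : R →+* S)
    (x : TruncatedWittVector p n R) (i : Fin n) : (truncMap n f x).coeff i = f (x.coeff i) :=
  TruncatedWittVector.coeff_mk _ _

/-- The zeroth coordinate `W_{m+1}(S) → S`. -/
def residue (m : ℕ) (S : Type*) [CommRing S] : TruncatedWittVector p (m + 1) S →+* S where
  toFun x := x.coeff 0
  map_one' := by
    rw [← map_one (WittVector.truncate (p := p) (R := S) (m + 1)), WittVector.coeff_truncate]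
    simp
  map_zero' := TruncatedWittVector.coeff_zero _ _ _ _
  map_mul' x y := by
    obtain ⟨a, rfl⟩ := WittVector.truncate_surjective p (m + 1) S x
    obtain ⟨b, rfl⟩ := WittVector.truncate_surjective p (m + 1) S y
    rw [← map_mul, WittVector.coeff_truncate, WittVector.coeff_truncate,
      WittVector.coeff_truncate]
    exact map_mul WittVector.constantCoeff a b
  map_add' x y := by
    obtain ⟨a, rfl⟩ := WittVector.truncate_surjective p (m + 1) S x
    obtain ⟨b, rfl⟩ := WittVector.truncate_surjective p (m + 1) S y
    rw [← map_add, WittVector.coeff_truncate, WittVector.coeff_truncate,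
      WittVector.coeff_truncate]
    exact map_add WittVector.constantCoeff a b

theorem residue_apply (m : ℕ) {S : Type*} [CommRing S] (x : TruncatedWittVector p (m + 1) S) :
    residue p m S x = x.coeff 0 := rfl

variable {k : Type*} [Field k] [CharP k p]

theorem isUnit_natCast_truncated {u : ℕ} (hu : ¬ p ∣ u) (n : ℕ) :
    IsUnit (u : TruncatedWittVector p n k) := by
  have hc : Nat.Coprime u (p ^ n) :=
    (((Fact.out : p.Prime).coprime_iff_not_dvd.mpr hu).symm).pow_right n
  obtain ⟨a, b, hab⟩ := Nat.isCoprime_iff_coprime.mpr hc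
  have h := congrArg (Int.cast : ℤ → TruncatedWittVector p n k) hab
  push_cast at h
  rw [truncated_p_pow, mul_zero, add_zero] at h
  exact IsUnit.of_mul_eq_one_right _ h

/-- In characteristic `p`, coordinate `i` of `p^i c` is `c_0^(p^i)`, and it survives the truncation
since `i ≤ m`. -/
theorem residue_eq_zero_of_p_pow_mul_eq_zero {m i : ℕ} (hi : i ≤ m)
    {c : TruncatedWittVector p (m + 1) k} (h : (p : TruncatedWittVector p (m + 1) k) ^ i * c = 0) :
    residue p m k c = 0 := by
  obtain ⟨y, rfl⟩ := WittVector.truncate_surjective p (m + 1) k c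
  have h1 : WittVector.truncate (m + 1) (y * (p : WittVector p k) ^ i) = 0 := by
    rw [map_mul, map_pow, map_natCast, mul_comm, h]
  have h2 : (y * (p : WittVector p k) ^ i).coeff (0 + i) = 0 :=
    (WittVector.mem_ker_truncate (m + 1) _).mp h1 _ (by omega)
  rw [WittVector.mul_pow_charP_coeff_succ] at h2
  rw [residue_apply, WittVector.coeff_truncate]
  exact eq_zero_of_pow_eq_zero h2

/-- The factors `p` are split off one at a time: as long as the total exponent stays at most `m`,
the cofactor has zero residue, hence is divisible by `p` because `k` is perfect. -/
theorem p_pow_dvd_of_p_pow_mul_eq_zero [PerfectRing k p] {m v l : ℕ} (hvl : v + l ≤ m + 1)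
    {c : TruncatedWittVector p (m + 1) k} (h : (p : TruncatedWittVector p (m + 1) k) ^ v * c = 0) :
    (p : TruncatedWittVector p (m + 1) k) ^ l ∣ c := by
  induction l with
  | zero => simp
  | succ l ih =>
    obtain ⟨b, rfl⟩ := ih (by omega)
    rw [← mul_assoc, ← pow_add] at h
    obtain ⟨a, rfl⟩ := truncated_p_dvd p k m b
      (residue_eq_zero_of_p_pow_mul_eq_zero p (by omega) h)
    exact ⟨a, by ring⟩

/-- Only the last coordinate of `c` can be nonzero, and `p = VF` shifts it out of the truncation. -/
theorem p_mul_eq_zero_of_res_eq_zero {n : ℕ} {c : TruncatedWittVector p (n + 1) k}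
    (h : res n c = 0) : (p : TruncatedWittVector p (n + 1) k) * c = 0 := by
  obtain ⟨y, rfl⟩ := WittVector.truncate_surjective p (n + 1) k c
  rw [res, TruncatedWittVector.truncate_wittVector_truncate] at h
  have hy := (WittVector.mem_ker_truncate n y).mp h
  rw [mul_comm, ← map_natCast (WittVector.truncate (p := p) (R := k) (n + 1)), ← map_mul]
  refine (WittVector.mem_ker_truncate (n + 1) _).mpr fun i hi => ?_
  cases i with
  | zero => exact WittVector.mul_charP_coeff_zero y
  | succ i =>
    rw [WittVector.mul_charP_coeff_succ, hy i (by omega), zero_pow (Fact.out : p.Prime).ne_zero]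

theorem eq_sum_p_pow_mul_teichmuller [PerfectRing k p] (m : ℕ)
    (y : TruncatedWittVector p (m + 1) k) :
    y = ∑ i : Fin (m + 1), (p : TruncatedWittVector p (m + 1) k) ^ (i : ℕ) *
      WittVector.truncate (m + 1)
        (WittVector.teichmuller p (((frobeniusEquiv k p).symm ^ (i : ℕ)) (y.coeff i))) := by
  obtain ⟨x, rfl⟩ := WittVector.truncate_surjective p (m + 1) k y
  obtain ⟨c, hc⟩ := WittVector.dvd_sub_sum_teichmuller_iterateFrobeniusEquiv_coeff x m
  have h := congrArg (WittVector.truncate (m + 1)) hc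
  rw [map_mul, map_pow, map_natCast, truncated_p_pow, zero_mul, map_sub, sub_eq_zero] at h
  have hx : ∀ i : Fin (m + 1), (WittVector.truncate (m + 1) x).coeff i = x.coeff i :=
    WittVector.coeff_truncate x
  simp only [hx]
  rw [h, map_sum, Finset.sum_fin_eq_sum_range, ← Nat.range_succ_eq_Iic]
  refine Finset.sum_congr rfl fun i hi => ?_
  rw [dif_pos (Finset.mem_range.mp hi), map_mul, map_pow, map_natCast, mul_comm]

end TruncatedWittVectors

/-! ### The ghost map as an injective ring homomorphism -/

section Ghost

variable (p : ℕ) [Fact p.Prime] (k : Type*) [Field k]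

theorem coeff_polyLift (n : ℕ) {d : ℕ} (f : MvPolynomial (Fin d) k) (e : Fin d →₀ ℕ) :
    coeff e (polyLift p k n f) =
      WittVector.truncate n (WittVector.teichmuller p (coeff e f)) := by
  unfold polyLift
  rw [coeff_sum]
  simp only [coeff_monomial]
  rw [Finset.sum_ite_eq']
  split_ifs with h
  · rfl
  · rw [notMem_support_iff.mp h, WittVector.teichmuller_zero, map_zero]

theorem polyLift_zero (n d : ℕ) : polyLift p k n (0 : MvPolynomial (Fin d) k) = 0 := by
  simp [polyLift]

theorem polyLift_monomial (n : ℕ) {d : ℕ} (e : Fin d →₀ ℕ) (a : k) :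
    polyLift p k n (monomial e a) =
      monomial e (WittVector.truncate n (WittVector.teichmuller p a)) := by
  ext u
  rw [coeff_polyLift, coeff_monomial, coeff_monomial]
  split_ifs
  · rfl
  · rw [WittVector.teichmuller_zero, map_zero]

theorem map_res_polyLift (n : ℕ) {d : ℕ} (f : MvPolynomial (Fin d) k) :
    map (res n) (polyLift p k (n + 1) f) = polyLift p k n f := by
  ext e
  rw [coeff_map, coeff_polyLift, coeff_polyLift, res,
    TruncatedWittVector.truncate_wittVector_truncate]

theorem map_residue_polyLift (m : ℕ) {d : ℕ} (f : MvPolynomial (Fin d) k) :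
    map (residue p m k) (polyLift p k (m + 1) f) = f := by
  ext e
  rw [coeff_map, coeff_polyLift, residue_apply, WittVector.coeff_truncate]
  simp

/-- Surjectivity of `W(A_n) → W_n(A)`, through which the multiplicativity and additivity of the
ghost component descend to `ghostTilde`. -/
theorem exists_truncate_map_eq (m : ℕ) {d : ℕ}
    (x : TruncatedWittVector p (m + 1) (MvPolynomial (Fin d) k)) :
    ∃ G : WittVector p (MvPolynomial (Fin d) (TruncatedWittVector p (m + 1) k)),
      WittVector.truncate (m + 1) (WittVector.map (map (residue p m k)) G) = x := by
  obtain ⟨X, rfl⟩ := WittVector.truncate_surjective p (m + 1) _ x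
  refine ⟨WittVector.mk p fun i => polyLift p k (m + 1) (X.coeff i), ?_⟩
  congr 1
  ext1 i
  rw [WittVector.map_coeff, WittVector.coeff_mk, map_residue_polyLift]

variable [CharP k p] [PerfectRing k p]

theorem ghostTilde_eq_of_map_residue (m : ℕ) {d : ℕ}
    (x : TruncatedWittVector p (m + 1) (MvPolynomial (Fin d) k))
    (g : Fin (m + 1) → MvPolynomial (Fin d) (TruncatedWittVector p (m + 1) k))
    (hg : ∀ i, map (residue p m k) (g i) = x.coeff i) :
    ghostTilde p k (m + 1) x =
      ∑ i : Fin (m + 1), (p : MvPolynomial (Fin d) (TruncatedWittVector p (m + 1) k)) ^ (i : ℕ) *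
        g i ^ p ^ (m - (i : ℕ)) :=
  ghostTilde_eq p k m x g fun i e => by rw [← hg i, coeff_map, residue_apply]

/-- `ghostTilde` is the factorisation of the top ghost component through `W_n(A_n) → W_n(A)`. -/
theorem ghostTilde_truncate_map (m : ℕ) {d : ℕ}
    (G : WittVector p (MvPolynomial (Fin d) (TruncatedWittVector p (m + 1) k))) :
    ghostTilde p k (m + 1)
        (WittVector.truncate (m + 1) (WittVector.map (map (residue p m k)) G)) =
      WittVector.ghostComponent m G := by
  rw [ghostTilde_eq_of_map_residue p k m _ (fun i => G.coeff i) fun i => by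
    rw [WittVector.coeff_truncate, WittVector.map_coeff], WittVector.ghostComponent_apply,
    aeval_wittPolynomial, Finset.sum_range]

/-- `ghostTilde` as a ring homomorphism `W_n(A) → A_n`. -/
noncomputable def ghostHom (n d : ℕ) : TruncatedWittVector p n (MvPolynomial (Fin d) k) →+*
    MvPolynomial (Fin d) (TruncatedWittVector p n k) :=
  match n with
  | 0 =>
    have : Subsingleton (MvPolynomial (Fin d) (TruncatedWittVector p 0 k)) :=
      have := subsingleton_truncated_zero p k
      Module.subsingleton (TruncatedWittVector p 0 k) _
    { toFun := ghostTilde p k 0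
      map_one' := Subsingleton.elim _ _
      map_zero' := Subsingleton.elim _ _
      map_mul' := fun _ _ => Subsingleton.elim _ _
      map_add' := fun _ _ => Subsingleton.elim _ _ }
  | m + 1 =>
    { toFun := ghostTilde p k (m + 1)
      map_one' := by
        have := ghostTilde_truncate_map p k m (d := d) 1
        rwa [map_one, map_one, map_one] at this
      map_zero' := by
        have := ghostTilde_truncate_map p k m (d := d) 0
        rwa [map_zero, map_zero, map_zero] at this
      map_mul' := fun x y => by
        obtain ⟨G, rfl⟩ := exists_truncate_map_eq p k m x
        obtain ⟨H, rfl⟩ := exists_truncate_map_eq p k m y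
        rw [← map_mul, ← map_mul, ghostTilde_truncate_map, ghostTilde_truncate_map,
          ghostTilde_truncate_map, map_mul]
      map_add' := fun x y => by
        obtain ⟨G, rfl⟩ := exists_truncate_map_eq p k m x
        obtain ⟨H, rfl⟩ := exists_truncate_map_eq p k m y
        rw [← map_add, ← map_add, ghostTilde_truncate_map, ghostTilde_truncate_map,
          ghostTilde_truncate_map, map_add] }

theorem ghostHom_apply {n d : ℕ} (x : TruncatedWittVector p n (MvPolynomial (Fin d) k)) :
    ghostHom p k n d x = ghostTilde p k n x := by
  cases n <;> rfl

/-- If the coordinates before the `i`-th vanish, the ghost value is `p^i` times a lift of a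
`p`-power of the `i`-th coordinate. Its vanishing forces that power to vanish in `A`, which is
reduced. -/
theorem ghostHom_injective (n d : ℕ) : Function.Injective (ghostHom p k n d) := by
  cases n with
  | zero =>
    have := subsingleton_truncated_zero p (MvPolynomial (Fin d) k)
    exact Function.injective_of_subsingleton _
  | succ m =>
    refine (injective_iff_map_eq_zero _).mpr fun x hx => ?_
    rw [ghostHom_apply, ghostTilde] at hx
    have key : ∀ i (hi : i < m + 1), x.coeff ⟨i, hi⟩ = 0 := by
      intro i
      induction i using Nat.strong_induction_on with
      | _ i ih =>
        intro hi
        -- Every summand is `p^i` times a multiple of `p`, apart from the contribution of `l = i`.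
        have hfac : ∀ l : Fin (m + 1), ∃ y,
            (p : MvPolynomial (Fin d) (TruncatedWittVector p (m + 1) k)) ^ (l : ℕ) *
              polyLift p k (m + 1) (x.coeff l) ^ p ^ (m + 1 - 1 - (l : ℕ)) =
            (p : MvPolynomial (Fin d) (TruncatedWittVector p (m + 1) k)) ^ i *
              ((if l = ⟨i, hi⟩ then
                polyLift p k (m + 1) (x.coeff ⟨i, hi⟩) ^ p ^ (m + 1 - 1 - i) else 0) + p * y) := by
          intro l
          rcases lt_trichotomy (l : ℕ) i with h | h | h
          · refine ⟨0, ?_⟩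
            rw [if_neg (by rintro rfl; simp at h), show x.coeff l = 0 from ih l h l.2,
              polyLift_zero, zero_pow (pow_ne_zero _ (Fact.out : p.Prime).ne_zero)]
            simp
          · obtain rfl : l = ⟨i, hi⟩ := Fin.ext h
            exact ⟨0, by simp⟩
          · refine ⟨p ^ ((l : ℕ) - i - 1) * polyLift p k (m + 1) (x.coeff l) ^
              p ^ (m + 1 - 1 - (l : ℕ)), ?_⟩
            rw [if_neg (by rintro rfl; simp at h), zero_add, ← mul_assoc, ← mul_assoc,
              ← pow_succ, ← pow_add]
            congr 2
            omega
        choose y hy using hfac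
        rw [Finset.sum_congr rfl fun l _ => hy l, ← Finset.mul_sum, Finset.sum_add_distrib,
          Finset.sum_ite_eq' Finset.univ, if_pos (Finset.mem_univ _), ← Finset.mul_sum] at hx
        set g := polyLift p k (m + 1) (x.coeff ⟨i, hi⟩) ^ p ^ (m + 1 - 1 - i) +
          (p : MvPolynomial (Fin d) (TruncatedWittVector p (m + 1) k)) * ∑ l, y l with hg
        have hres : map (residue p m k) g = 0 := by
          ext e
          rw [coeff_map, coeff_zero]
          refine residue_eq_zero_of_p_pow_mul_eq_zero p (Nat.lt_succ_iff.mp hi) ?_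
          have := congrArg (coeff e) hx
          rwa [← map_natCast (C (σ := Fin d) (R := TruncatedWittVector p (m + 1) k)), ← map_pow,
            coeff_C_mul, coeff_zero] at this
        have hp0 : (p : MvPolynomial (Fin d) k) = 0 := by
          rw [← map_natCast (C (σ := Fin d) (R := k)), CharP.cast_eq_zero, map_zero]
        rw [hg, map_add, map_mul, map_natCast, hp0, zero_mul, add_zero, map_pow,
          map_residue_polyLift] at hres
        exact eq_zero_of_pow_eq_zero hres
    ext1 i
    rw [TruncatedWittVector.coeff_zero]
    exact key i i.2

end Ghost

/-! ### The image of the ghost map and the restricted operators -/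

section Image

variable (p : ℕ) [Fact p.Prime] (k : Type*) [Field k]

/-- The congruences `p^(n-1) ∣ e_j a_e` which characterise, among the polynomials `∑ a_e t^e` in
`A_n`, those in the image of `ghostTilde`. -/
def IsAdmissible {n d : ℕ} (g : MvPolynomial (Fin d) (TruncatedWittVector p n k)) : Prop :=
  ∀ (e : Fin d →₀ ℕ) (j : Fin d),
    (p : TruncatedWittVector p n k) ^ (n - 1) ∣ (e j : TruncatedWittVector p n k) * coeff e g

variable {p k}

/-- In the direction of differentiation, `e_i (e_i + r choose r) = (e_i + r - 1 choose r) (e_i + r)`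
for `e_i > 0`, so the new congruence is a multiple of the old one. The other exponents do not
change. -/
theorem IsAdmissible.hasse {n d : ℕ} {g : MvPolynomial (Fin d) (TruncatedWittVector p n k)}
    (hg : IsAdmissible p k g) (i : Fin d) (r : ℕ) :
    IsAdmissible p k (hasse (TruncatedWittVector p n k) i r g) := by
  intro e j
  have h := hg (e + Finsupp.single i r) j
  rw [coeff_hasse]
  by_cases hij : i = j
  · subst hij
    rw [Finsupp.add_apply, Finsupp.single_eq_same] at h
    rcases Nat.eq_zero_or_pos (e i) with h0 | hpos
    · simp [h0]
    · obtain ⟨s, hs⟩ := Nat.exists_eq_succ_of_ne_zero hpos.ne'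
      have hc : e i * (e i + r).choose r = (s + r).choose r * (e i + r) := by
        have := Nat.choose_mul_succ_eq (s + r) r
        rw [show s + r + 1 - r = s + 1 by omega, show s + r + 1 = s + 1 + r by omega] at this
        rw [hs, Nat.succ_eq_add_one, this, mul_comm]
      have hc' := congrArg (Nat.cast : ℕ → TruncatedWittVector p n k) hc
      push_cast at hc' h
      rw [← mul_assoc, hc', mul_assoc]
      exact h.mul_left _
  · rw [Finsupp.add_apply, Finsupp.single_eq_of_ne' hij, add_zero] at h
    rw [mul_left_comm]
    exact h.mul_left _

/-- The numbers `e_j a_e` are the coefficients of `∂/∂t_j`, and the derivative of `p^i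
g^(p^(n-1-i))` is divisible by `p^(n-1)`. -/
theorem isAdmissible_ghostTilde {n d : ℕ}
    (x : TruncatedWittVector p n (MvPolynomial (Fin d) k)) :
    IsAdmissible p k (ghostTilde p k n x) := by
  intro e j
  have h : (C ((p : TruncatedWittVector p n k) ^ (n - 1)) :
      MvPolynomial (Fin d) (TruncatedWittVector p n k)) ∣ pderiv j (ghostTilde p k n x) := by
    rw [ghostTilde, map_sum]
    refine Finset.dvd_sum fun i _ => ?_
    have hp : (p : MvPolynomial (Fin d) (TruncatedWittVector p n k)) ^ (i : ℕ) =
        C ((p : TruncatedWittVector p n k) ^ (i : ℕ)) := by simp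
    have hn : n - 1 = i + (n - 1 - i) := by omega
    rw [hp, pderiv_C_mul, Derivation.leibniz_pow, smul_eq_mul, nsmul_eq_mul, ← mul_assoc]
    refine Dvd.dvd.mul_right ?_ _
    conv_lhs => rw [hn]
    rw [pow_add, map_mul]
    exact mul_dvd_mul_left _ (by simp)
  rcases Nat.eq_zero_or_pos (e j) with h0 | hpos
  · simp [h0]
  · obtain ⟨u, rfl⟩ : ∃ u, e = u + Finsupp.single j 1 :=
      ⟨e - Finsupp.single j 1, (tsub_add_cancel_of_le (by simpa using Nat.succ_le_of_lt hpos)).symm⟩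
    have := (C_dvd_iff_dvd_coeff _ _).mp h u
    rw [coeff_pderiv] at this
    simpa [mul_comm] using this

variable (p k)

theorem ghostTilde_truncMap_C (n d : ℕ) (c : TruncatedWittVector p n k) :
    ghostTilde p k n (truncMap n (C (σ := Fin d)) c) =
      C (∑ i : Fin n, (p : TruncatedWittVector p n k) ^ (i : ℕ) *
        WittVector.truncate n (WittVector.teichmuller p (c.coeff i)) ^ p ^ (n - 1 - (i : ℕ))) := by
  have h : ∀ a : k, polyLift p k n (C (σ := Fin d) a) =
      C (WittVector.truncate n (WittVector.teichmuller p a)) := fun a =>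
    polyLift_monomial p k n 0 a
  simp only [ghostTilde, coeff_truncMap, h, map_sum, map_mul, map_pow, map_natCast]

theorem ghostTilde_single (m d : ℕ) (i : Fin (m + 1)) (e : Fin d →₀ ℕ) :
    ghostTilde p k (m + 1) (TruncatedWittVector.mk p fun l =>
      if l = i then (monomial e 1 : MvPolynomial (Fin d) k) else 0) =
      monomial (p ^ (m - (i : ℕ)) • e) ((p : TruncatedWittVector p (m + 1) k) ^ (i : ℕ)) := by
  rw [ghostTilde, Finset.sum_eq_single i]
  · rw [TruncatedWittVector.coeff_mk, if_pos rfl, polyLift_monomial, map_one, map_one,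
      monomial_pow, one_pow, ← map_natCast (C (σ := Fin d)), ← map_pow, C_mul_monomial, mul_one,
      Nat.add_sub_cancel]
  · intro l _ hl
    rw [TruncatedWittVector.coeff_mk, if_neg hl, polyLift_zero,
      zero_pow (pow_ne_zero _ (Fact.out : p.Prime).ne_zero), mul_zero]
  · simp

variable [CharP k p] [PerfectRing k p]

/-- On constants the ghost map is the `m`-th power of the Frobenius of `W_(m+1)(k)`, which is
surjective as `k` is perfect. Taking `p^m`-th roots of the coordinates turns the ghost sum into the
Teichmüller expansion of `b`. -/
theorem exists_ghostTilde_truncMap_C_eq (m d : ℕ) (b : TruncatedWittVector p (m + 1) k) :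
    ∃ c, ghostTilde p k (m + 1) (truncMap (m + 1) (C (σ := Fin d)) c) = C b := by
  refine ⟨TruncatedWittVector.mk p fun i => ((frobeniusEquiv k p).symm ^ m) (b.coeff i), ?_⟩
  rw [ghostTilde_truncMap_C, eq_sum_p_pow_mul_teichmuller p m b]
  congr 1
  refine Finset.sum_congr rfl fun i _ => ?_
  rw [← eq_sum_p_pow_mul_teichmuller p m b, TruncatedWittVector.coeff_mk, ← map_pow, ← map_pow,
    Nat.add_sub_cancel]
  congr 3
  have hm : m = (m - i) + i := by omega
  have hroot : ∀ (s : ℕ) (a : k), ((frobeniusEquiv k p).symm ^ s) a ^ p ^ s = a := by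
    intro s
    induction s with
    | zero => simp
    | succ s ih =>
      intro a
      rw [pow_succ' (frobeniusEquiv k p).symm, RingAut.mul_apply, pow_succ', pow_mul,
        frobeniusEquiv_symm_pow_p, ih]
  have hsplit : (frobeniusEquiv k p).symm ^ m =
      (frobeniusEquiv k p).symm ^ (m - (i : ℕ)) * (frobeniusEquiv k p).symm ^ (i : ℕ) := by
    rw [← pow_add, ← hm]
  rw [hsplit, RingAut.mul_apply, hroot]

/-- Such a monomial is a constant times `p^i (t^u)^(p^(m-i))`, the ghost of the vector whose only
nonzero coordinate is `t^u`. -/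
theorem monomial_mem_range_ghostHom {m d i : ℕ} (hi : i ≤ m) {e : Fin d →₀ ℕ}
    {a : TruncatedWittVector p (m + 1) k} (he : ∀ j, p ^ (m - i) ∣ e j)
    (ha : (p : TruncatedWittVector p (m + 1) k) ^ i ∣ a) :
    monomial e a ∈ (ghostHom p k (m + 1) d).range := by
  obtain ⟨b, rfl⟩ := ha
  obtain ⟨u, rfl⟩ : ∃ u : Fin d →₀ ℕ, e = p ^ (m - i) • u := by
    refine ⟨Finsupp.equivFunOnFinite.symm fun j => e j / p ^ (m - i), ?_⟩
    ext j
    simp [Nat.mul_div_cancel' (he j)]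
  obtain ⟨c, hc⟩ := exists_ghostTilde_truncMap_C_eq p k m d b
  have h := ghostTilde_single p k m d ⟨i, Nat.lt_succ_iff.mpr hi⟩ u
  rw [← ghostHom_apply] at h hc
  rw [mul_comm, ← C_mul_monomial, ← h, ← hc]
  exact mul_mem ⟨_, rfl⟩ ⟨_, rfl⟩

/-- Each monomial `a t^e` lies in the image. If `p^v`, with `v < m`, is the exact power of `p`
dividing all exponents, the congruence at an exponent of valuation `v` gives `p^(m-v) ∣ a`; if `p^m`
divides all exponents, nothing is needed of `a`. -/
theorem IsAdmissible.mem_range {n d : ℕ} {g : MvPolynomial (Fin d) (TruncatedWittVector p n k)}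
    (hg : IsAdmissible p k g) : g ∈ (ghostHom p k n d).range := by
  cases n with
  | zero =>
    have := subsingleton_truncated_zero p k
    have : Subsingleton (MvPolynomial (Fin d) (TruncatedWittVector p 0 k)) :=
      Module.subsingleton (TruncatedWittVector p 0 k) _
    exact ⟨0, Subsingleton.elim _ _⟩
  | succ m =>
    rw [g.as_sum]
    refine sum_mem fun e _ => ?_
    have he := hg e
    rw [Nat.add_sub_cancel] at he
    by_cases hm : ∀ j, p ^ m ∣ e j
    · exact monomial_mem_range_ghostHom p k (Nat.zero_le m) hm (by simp)
    · classical
      have hex : ∃ v, ¬ ∀ j, p ^ v ∣ e j := ⟨m, hm⟩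
      obtain ⟨v, hv⟩ : ∃ v, Nat.find hex = v + 1 := by
        refine Nat.exists_eq_succ_of_ne_zero fun h0 => ?_
        have := Nat.find_spec hex
        rw [h0] at this
        simp at this
      have hvm : v + 1 ≤ m := hv ▸ Nat.find_min' hex hm
      have hall : ∀ j, p ^ v ∣ e j := not_not.mp (Nat.find_min hex (by omega : v < Nat.find hex))
      have hnot := Nat.find_spec hex
      rw [hv] at hnot
      obtain ⟨j, hj⟩ := not_forall.mp hnot
      obtain ⟨u, hu⟩ := hall j
      have hpu : ¬ p ∣ u := fun h => hj (by rw [hu, pow_succ]; exact mul_dvd_mul_left _ h)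
      have hunit : IsUnit (u : TruncatedWittVector p (m + 1) k) := isUnit_natCast_truncated p hpu _
      obtain ⟨b, hb⟩ := he j
      rw [hu, Nat.cast_mul, Nat.cast_pow] at hb
      -- The zero divisor `p^v` can be cancelled only up to its annihilator, but that annihilator
      -- consists of multiples of `p^(m-v)`.
      have hz : (p : TruncatedWittVector p (m + 1) k) ^ v *
          ((u : TruncatedWittVector p (m + 1) k) * coeff e g -
            (p : TruncatedWittVector p (m + 1) k) ^ (m - v) * b) = 0 := by
        rw [mul_sub, ← mul_assoc, hb, ← mul_assoc, ← pow_add, show v + (m - v) = m by omega,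
          sub_self]
      have hdvd := p_pow_dvd_of_p_pow_mul_eq_zero p (l := m - v) (by omega) hz
      have hdvd' : (p : TruncatedWittVector p (m + 1) k) ^ (m - v) ∣ coeff e g :=
        (hunit.dvd_mul_left).mp ((dvd_sub_left (dvd_mul_right _ _)).mp hdvd)
      refine monomial_mem_range_ghostHom p k (i := m - v) (by omega) ?_ hdvd'
      rwa [show m - (m - v) = v by omega]

/-- An operator on `A_n` preserving the congruences `IsAdmissible` restricts to `W_n(A)`. -/
theorem exists_restriction {n d : ℕ}
    (D : Module.End (TruncatedWittVector p n k)
      (MvPolynomial (Fin d) (TruncatedWittVector p n k)))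
    (hD : ∀ g, IsAdmissible p k g → IsAdmissible p k (D g)) :
    ∃ δ : Module.End (TruncatedWittVector p n k)
      (TruncatedWittVector p n (MvPolynomial (Fin d) k)),
      ∀ x, ghostHom p k n d (δ x) = D (ghostHom p k n d x) := by
  have h : ∀ x, ∃ y, ghostHom p k n d y = D (ghostHom p k n d x) := fun x => by
    rw [ghostHom_apply]
    exact (hD _ (isAdmissible_ghostTilde x)).mem_range
  choose δ hδ using h
  refine ⟨{ toFun := δ, map_add' := fun x y => ?_, map_smul' := fun c x => ?_ }, hδ⟩
  · apply ghostHom_injective p k n d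
    rw [map_add, hδ, hδ, hδ, map_add, map_add]
  · apply ghostHom_injective p k n d
    -- The ghost map need not be `W_n(k)`-linear, but it sends scalars to constant polynomials, so
    -- linearity of `D` suffices.
    have hc : ∃ b, ghostHom p k n d (algebraMap _ _ c) = C b :=
      ⟨_, (ghostHom_apply p k _).trans (ghostTilde_truncMap_C p k n d c)⟩
    obtain ⟨b, hb⟩ := hc
    rw [RingHom.id_apply, Algebra.smul_def, Algebra.smul_def, hδ, map_mul (ghostHom p k n d),
      map_mul (ghostHom p k n d), hδ, hb, ← smul_eq_C_mul, ← smul_eq_C_mul, map_smul]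

theorem isRestriction_wittDiffOp (n : ℕ) {d : ℕ} (j : Fin d) (r : ℕ) :
    IsRestriction p k (hasse (TruncatedWittVector p n k) j r) (wittDiffOp p k n j r) := by
  have hex : ∃ δ, IsRestriction p k (hasse (TruncatedWittVector p n k) j r) δ := by
    obtain ⟨δ, hδ⟩ := exists_restriction p k (hasse (TruncatedWittVector p n k) j r)
      fun g hg => hg.hasse j r
    exact ⟨δ, ⟨r, (isDiffOp_hasse j r).of_injective (ghostHom_injective p k n d) hδ⟩,
      fun x => by simpa only [ghostHom_apply] using hδ x⟩
  rw [wittDiffOp, restriction, dif_pos hex]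
  exact hex.choose_spec

theorem ghostHom_wittDiffOp (n : ℕ) {d : ℕ} (j : Fin d) (r : ℕ)
    (x : TruncatedWittVector p n (MvPolynomial (Fin d) k)) :
    ghostHom p k n d (wittDiffOp p k n j r x) =
      hasse (TruncatedWittVector p n k) j r (ghostHom p k n d x) := by
  rw [ghostHom_apply, ghostHom_apply]
  exact (isRestriction_wittDiffOp p k n j r).2 x

theorem isDiffOp_wittDiffOp (n : ℕ) {d : ℕ} (j : Fin d) (r : ℕ) :
    IsDiffOp r (wittDiffOp p k n j r) :=
  (isDiffOp_hasse j r).of_injective (ghostHom_injective p k n d) (ghostHom_wittDiffOp p k n j r)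

theorem IsRestriction.eq {n d : ℕ}
    {D : Module.End (TruncatedWittVector p n k)
      (MvPolynomial (Fin d) (TruncatedWittVector p n k))}
    {δ ε : Module.End (TruncatedWittVector p n k)
      (TruncatedWittVector p n (MvPolynomial (Fin d) k))}
    (hδ : IsRestriction p k D δ) (hε : IsRestriction p k D ε) : δ = ε := by
  refine LinearMap.ext fun x => ghostHom_injective p k n d ?_
  rw [ghostHom_apply, ghostHom_apply, hδ.2, hε.2]

end Image

/-! ### Compatibility with Frobenius and restriction -/

section Frobenius

variable (p : ℕ) [Fact p.Prime] (k : Type*) [Field k] [CharP k p]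

/-- The lift of Frobenius to `A_n` which is the Witt vector Frobenius on `W_n(k)` and maps `t_j` to
`t_j^p`. -/
noncomputable def frobLift (n d : ℕ) : MvPolynomial (Fin d) (TruncatedWittVector p n k) →+*
    MvPolynomial (Fin d) (TruncatedWittVector p n k) :=
  (expand p : _ →ₐ[TruncatedWittVector p n k] _).toRingHom.comp
    (map (truncMap n (frobenius k p)))

theorem frobLift_monomial (n : ℕ) {d : ℕ} (e : Fin d →₀ ℕ) (a : TruncatedWittVector p n k) :
    frobLift p k n d (monomial e a) = monomial (p • e) (truncMap n (frobenius k p) a) := by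
  simp [frobLift, expand_monomial]

theorem frobLift_injective (n d : ℕ) : Function.Injective (frobLift p k n d) := by
  have h : Function.Injective (truncMap (p := p) n (frobenius k p)) := by
    intro x y hxy
    ext i
    apply frobenius_inj k p
    rw [← coeff_truncMap, ← coeff_truncMap, hxy]
  intro f g hfg
  exact map_injective _ h (expand_injective (Fact.out : p.Prime).pos hfg)

theorem map_residue_frobLift (m : ℕ) {d : ℕ}
    (g : MvPolynomial (Fin d) (TruncatedWittVector p (m + 1) k)) :
    map (residue p m k) (frobLift p k (m + 1) d g) = map (residue p m k) g ^ p := by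
  have h : (map (residue p m k)).comp (frobLift p k (m + 1) d) =
      (frobenius (MvPolynomial (Fin d) k) p).comp (map (residue p m k)) := by
    refine ringHom_ext (fun c => ?_) fun j => ?_
    · simp [frobLift, residue_apply, coeff_truncMap, frobenius_def]
    · simp [frobLift, frobenius_def]
  exact congrArg (fun f => f g) h

/-- For `e_j = p^v u` with `p ∤ u`, the hypothesis gives `p^(v+1) a = 0`, so binomial coefficients
matter only modulo `p^(v+1)` and `pow_dvd_choose_mul_sub` applies. The exponent `e_j = 0` is treated
apart. -/
theorem hasse_frobLift_monomial (n : ℕ) {d : ℕ} (j : Fin d) (r : ℕ) (e : Fin d →₀ ℕ)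
    (a : TruncatedWittVector p n k)
    (h : (p : TruncatedWittVector p n k) ^ (n - 1) ∣ (e j : TruncatedWittVector p n k) * a) :
    hasse (TruncatedWittVector p n k) j r (frobLift p k n d (monomial e a)) =
      if p ∣ r then frobLift p k n d (hasse (TruncatedWittVector p n k) j (r / p) (monomial e a))
      else 0 := by
  have hp : p.Prime := Fact.out
  set b := truncMap n (frobenius k p) a with hb
  have hpe : (p : TruncatedWittVector p n k) * (e j * a) = 0 := by
    obtain ⟨c, hc⟩ := h
    rw [hc, ← mul_assoc, ← pow_succ']
    cases n with
    | zero => have := subsingleton_truncated_zero p k; exact Subsingleton.elim _ _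
    | succ m => rw [Nat.add_sub_cancel, truncated_p_pow, zero_mul]
  have key : (((p * e j).choose r : ℕ) : TruncatedWittVector p n k) * b =
      (if p ∣ r then (((e j).choose (r / p) : ℕ) : TruncatedWittVector p n k) else 0) * b := by
    rcases Nat.eq_zero_or_pos (e j) with h0 | hpos
    · rw [h0, mul_zero]
      cases r with
      | zero => simp
      | succ r =>
        rw [Nat.choose_zero_succ]
        split_ifs with hr
        · obtain ⟨s, hs⟩ := Nat.exists_eq_succ_of_ne_zero
            (Nat.div_pos (Nat.le_of_dvd r.succ_pos hr) hp.pos).ne'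
          rw [hs, Nat.choose_zero_succ]
        · simp
    · obtain ⟨v, u, hpu, hu⟩ := Nat.exists_eq_pow_mul_and_not_dvd hpos.ne' p hp.ne_one
      have hunit : IsUnit (u : TruncatedWittVector p n k) := isUnit_natCast_truncated p hpu _
      have hz : (p : TruncatedWittVector p n k) ^ (v + 1) * a = 0 := by
        apply hunit.mul_left_cancel
        rw [mul_zero, ← hpe, hu]
        push_cast
        ring
      have hzb : (p : TruncatedWittVector p n k) ^ (v + 1) * b = 0 := by
        rw [hb, ← map_natCast (truncMap n (frobenius k p)), ← map_pow, ← map_mul, hz, map_zero]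
      obtain ⟨c, hc⟩ := pow_dvd_choose_mul_sub hp v u r
      have hc' := congrArg (Int.cast : ℤ → TruncatedWittVector p n k) hc
      push_cast at hc'
      rw [← sub_eq_zero, ← sub_mul, hu, hc', mul_right_comm, hzb, zero_mul]
  rw [frobLift_monomial, ← hb, hasse_monomial, Finsupp.smul_apply, smul_eq_mul, key]
  split_ifs with hr
  · obtain ⟨s, rfl⟩ := hr
    rw [Nat.mul_div_cancel_left _ hp.pos, hasse_monomial, frobLift_monomial,
      map_mul (truncMap n (frobenius k p)), map_natCast (truncMap n (frobenius k p))]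
    refine congrArg₂ (fun e c => monomial e c) ?_ rfl
    ext i
    by_cases hi : j = i
    · subst hi
      simp [Nat.mul_sub]
    · simp [Finsupp.single_eq_of_ne' hi]
  · simp

theorem hasse_frobLift {n d : ℕ} {g : MvPolynomial (Fin d) (TruncatedWittVector p n k)}
    (hg : IsAdmissible p k g) (j : Fin d) (r : ℕ) :
    hasse (TruncatedWittVector p n k) j r (frobLift p k n d g) =
      if p ∣ r then frobLift p k n d (hasse (TruncatedWittVector p n k) j (r / p) g)
      else 0 := by
  have h := fun e => hasse_frobLift_monomial p k n j r e (coeff e g) (hg e j)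
  rw [g.as_sum]
  split_ifs with hr
  · simp only [if_pos hr] at h
    simp only [map_sum]
    exact Finset.sum_congr rfl fun e _ => h e
  · simp only [if_neg hr] at h
    simp only [map_sum]
    exact Finset.sum_eq_zero fun e _ => h e

variable [PerfectRing k p]

theorem ghostHom_frobA (m d : ℕ) (x : TruncatedWittVector p (m + 1) (MvPolynomial (Fin d) k)) :
    ghostHom p k (m + 1) d (frobA p k (m + 1) d x) =
      frobLift p k (m + 1) d (ghostHom p k (m + 1) d x) := by
  rw [ghostHom_apply, ghostHom_apply, ghostTilde_eq_of_map_residue p k m _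
    fun i => frobLift p k (m + 1) d (polyLift p k (m + 1) (x.coeff i))]
  · simp [ghostTilde]
  · intro i
    rw [map_residue_frobLift, map_residue_polyLift, frobA, coeff_truncMap, frobenius_def]

/-- Both sides are `∑ p^i f_i^(p^(m+1-i))` over `i ≤ m`, with `f_i` lifting the coordinates: the
last ghost term dies because `p^(m+1) = 0`. This Frobenius twist is the source of `r/p` in the
relation for `R`. -/
theorem frobLift_ghostHom_res (m d : ℕ)
    (x : TruncatedWittVector p (m + 1 + 1) (MvPolynomial (Fin d) k)) :
    frobLift p k (m + 1) d (ghostHom p k (m + 1) d (res (m + 1) x)) =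
      map (res (m + 1)) (ghostHom p k (m + 1 + 1) d x) := by
  have hp : (p : MvPolynomial (Fin d) (TruncatedWittVector p (m + 1) k)) ^ (m + 1) = 0 := by
    rw [← map_natCast (C (σ := Fin d)), ← map_pow, truncated_p_pow, map_zero]
  rw [← ghostHom_frobA, ghostHom_apply, ghostHom_apply, ghostTilde_eq_of_map_residue p k m _
    fun i => polyLift p k (m + 1) (x.coeff i.castSucc) ^ p]
  · rw [ghostTilde, Fin.sum_univ_castSucc (n := m + 1), map_add, map_sum]
    simp only [map_mul, map_pow, map_natCast, map_res_polyLift, Fin.val_last, hp, zero_mul,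
      add_zero, Fin.val_castSucc]
    refine Finset.sum_congr rfl fun i _ => ?_
    rw [← pow_mul, ← pow_succ', show m - (i : ℕ) + 1 = m + 1 + 1 - 1 - i by omega]
  · intro i
    rw [map_pow, map_residue_polyLift, frobA, coeff_truncMap, frobenius_def, res,
      TruncatedWittVector.coeff_truncate]
    rfl

theorem frobLift_ghostHom_wittDiffOpDiv (n : ℕ) {d : ℕ} (j : Fin d) (r : ℕ)
    (x : TruncatedWittVector p n (MvPolynomial (Fin d) k)) :
    frobLift p k n d (ghostHom p k n d (wittDiffOpDiv p k n j r x)) =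
      hasse (TruncatedWittVector p n k) j r (frobLift p k n d (ghostHom p k n d x)) := by
  rw [hasse_frobLift p k (by rw [ghostHom_apply]; exact isAdmissible_ghostTilde x),
    wittDiffOpDiv]
  split_ifs
  · rw [ghostHom_wittDiffOp]
  · simp

/-- Equality may be tested after the injective map `F` ∘ ghost, which turns `R` into reduction of
coefficients; the latter commutes with `∂^[r]`. -/
theorem wittDiffOpDiv_res (n : ℕ) {d : ℕ} (j : Fin d) (r : ℕ)
    (x : TruncatedWittVector p (n + 1) (MvPolynomial (Fin d) k)) :
    wittDiffOpDiv p k n j r (res n x) = res n (wittDiffOp p k (n + 1) j r x) := by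
  cases n with
  | zero =>
    have := subsingleton_truncated_zero p (MvPolynomial (Fin d) k)
    exact Subsingleton.elim _ _
  | succ m =>
    apply ghostHom_injective p k (m + 1) d
    apply frobLift_injective p k (m + 1) d
    rw [frobLift_ghostHom_wittDiffOpDiv, frobLift_ghostHom_res, frobLift_ghostHom_res,
      ghostHom_wittDiffOp, map_hasse]

theorem wittDiffOp_frobA (m : ℕ) {d : ℕ} (j : Fin d) (r : ℕ)
    (x : TruncatedWittVector p (m + 1) (MvPolynomial (Fin d) k)) :
    wittDiffOp p k (m + 1) j r (frobA p k (m + 1) d x) =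
      frobA p k (m + 1) d (wittDiffOpDiv p k (m + 1) j r x) := by
  apply ghostHom_injective p k (m + 1) d
  rw [ghostHom_wittDiffOp, ghostHom_frobA, ghostHom_frobA, frobLift_ghostHom_wittDiffOpDiv]

end Frobenius

/-! ### Compatibility with Verschiebung and its filtration -/

section Verschiebung

variable (p : ℕ) [Fact p.Prime] (k : Type*) [Field k]

/-- On ghosts, `V` is multiplication by `p` of a lift from `A_n` to `A_(n+1)`; by
`C_p_mul_eq_of_map_res_eq` the choice of lift is immaterial. -/
theorem exists_ghostTilde_ver (n : ℕ) {d : ℕ}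
    (x : TruncatedWittVector p n (MvPolynomial (Fin d) k)) :
    ∃ y, map (res n) y = ghostTilde p k n x ∧
      ghostTilde p k (n + 1) (ver n x) =
        C (p : TruncatedWittVector p (n + 1) k) * y := by
  refine ⟨∑ i : Fin n, (p : MvPolynomial (Fin d) (TruncatedWittVector p (n + 1) k)) ^ (i : ℕ) *
    polyLift p k (n + 1) (x.coeff i) ^ p ^ (n - 1 - (i : ℕ)), ?_, ?_⟩
  · simp only [map_sum, map_mul, map_pow, map_natCast, map_res_polyLift, ghostTilde]
  · rw [ghostTilde, Fin.sum_univ_succ, ver, TruncatedWittVector.coeff_mk, Fin.cons_zero,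
      polyLift_zero, zero_pow (pow_ne_zero _ (Fact.out : p.Prime).ne_zero), mul_zero, zero_add,
      Finset.mul_sum]
    refine Finset.sum_congr rfl fun i _ => ?_
    rw [TruncatedWittVector.coeff_mk, Fin.cons_succ, Fin.val_succ, pow_succ', mul_assoc,
      map_natCast, show n + 1 - 1 - ((i : ℕ) + 1) = n - 1 - i by omega]

variable [CharP k p]

theorem C_p_mul_eq_of_map_res_eq {n d : ℕ}
    {y z : MvPolynomial (Fin d) (TruncatedWittVector p (n + 1) k)}
    (h : map (res n) y = map (res n) z) :
    C (p : TruncatedWittVector p (n + 1) k) * y = C (p : TruncatedWittVector p (n + 1) k) * z := by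
  rw [← sub_eq_zero, ← mul_sub]
  ext1 e
  rw [coeff_C_mul, coeff_zero]
  apply p_mul_eq_zero_of_res_eq_zero
  rw [← coeff_map, map_sub, h, sub_self, coeff_zero]

variable [PerfectRing k p]

theorem wittDiffOp_ver (n : ℕ) {d : ℕ} (j : Fin d) (r : ℕ)
    (x : TruncatedWittVector p n (MvPolynomial (Fin d) k)) :
    wittDiffOp p k (n + 1) j r (ver n x) = ver n (wittDiffOp p k n j r x) := by
  apply ghostHom_injective p k (n + 1) d
  obtain ⟨y, hy, hVx⟩ := exists_ghostTilde_ver p k n x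
  obtain ⟨z, hz, hVz⟩ := exists_ghostTilde_ver p k n (wittDiffOp p k n j r x)
  rw [ghostHom_wittDiffOp, ghostHom_apply, ghostHom_apply, hVx, hVz, ← smul_eq_C_mul, map_smul,
    smul_eq_C_mul]
  apply C_p_mul_eq_of_map_res_eq
  rw [map_hasse, hy, hz, ← ghostHom_apply, ← ghostHom_apply, ghostHom_wittDiffOp]

/-- Commuting past one `V ∘ R` multiplies the index by `p`: `∂^[r] V R = V ∂^[r] R = V R ∂^[pr]`.
Hence the induction runs over all `r` at once. -/
theorem wittDiffOp_mem_verFil (n : ℕ) {d : ℕ} (j : Fin d) (r i : ℕ)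
    {x : TruncatedWittVector p (n + 1) (MvPolynomial (Fin d) k)}
    (hx : x ∈ verFil p n i (MvPolynomial (Fin d) k)) :
    wittDiffOp p k (n + 1) j r x ∈ verFil p n i (MvPolynomial (Fin d) k) := by
  obtain ⟨x, rfl⟩ := hx
  induction i generalizing r with
  | zero => exact ⟨_, rfl⟩
  | succ i ih =>
    obtain ⟨y, hy⟩ := ih (p * r)
    refine ⟨y, ?_⟩
    have hres := wittDiffOpDiv_res p k n j (p * r)
      ((fun x : TruncatedWittVector p (n + 1) (MvPolynomial (Fin d) k) => ver n (res n x))^[i] x)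
    rw [wittDiffOpDiv, if_pos (dvd_mul_right p r),
      Nat.mul_div_cancel_left _ (Fact.out : p.Prime).pos] at hres
    rw [Function.iterate_succ_apply', Function.iterate_succ_apply', hy, ← hres, wittDiffOp_ver]

end Verschiebung

/-! ### Passage to multi-indices -/

section MultiIndex

/-- No linearity of `f` is required and the scalars may differ, so this covers `R`, `Φ_A` and the
bare map `V` alike. -/
theorem list_prod_intertwine {R S M N ι : Type*} [Semiring R] [Semiring S] [AddCommMonoid M]
    [Module R M] [AddCommMonoid N] [Module S N] {a : ι → Module.End R M} {b : ι → Module.End S N}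
    {f : N → M} (h : ∀ i x, a i (f x) = f (b i x)) (l : List ι) (x : N) :
    (l.map a).prod (f x) = f ((l.map b).prod x) := by
  induction l with
  | nil => rfl
  | cons i l ih =>
    rw [List.map_cons, List.prod_cons, List.map_cons, List.prod_cons, Module.End.mul_apply, ih, h,
      Module.End.mul_apply]

theorem list_prod_mem {R M ι : Type*} [Semiring R] [AddCommMonoid M] [Module R M]
    {a : ι → Module.End R M} {s : Set M} (h : ∀ i, ∀ x ∈ s, a i x ∈ s) (l : List ι) {x : M}
    (hx : x ∈ s) : (l.map a).prod x ∈ s := by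
  induction l with
  | nil => exact hx
  | cons i l ih =>
    rw [List.map_cons, List.prod_cons, Module.End.mul_apply]
    exact h i _ ih

end MultiIndex

end WittDiff

theorem mainTheorem4 (p : ℕ) [Fact p.Prime] (k : Type*) [Field k] [CharP k p] [PerfectRing k p]
    (d : ℕ) :
    -- `∂_{j,n}^{[r]}` is well defined on `W_n(A)`: it is the unique restriction, and has order `≤ r`
    (∀ (n : ℕ) (j : Fin d) (r : ℕ),
      WittDiff.IsRestriction p k (WittDiff.hasse (TruncatedWittVector p n k) j r)
        (WittDiff.wittDiffOp p k n j r) ∧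
      WittDiff.IsDiffOp r (WittDiff.wittDiffOp p k n j r) ∧
      ∀ δ, WittDiff.IsRestriction p k (WittDiff.hasse (TruncatedWittVector p n k) j r) δ →
        δ = WittDiff.wittDiffOp p k n j r) ∧
    -- the four relations for a single variable
    (∀ (n : ℕ) (j : Fin d) (r : ℕ),
      (∀ x, WittDiff.wittDiffOpDiv p k n j r (WittDiff.res n x) =
        WittDiff.res n (WittDiff.wittDiffOp p k (n + 1) j r x)) ∧
      (∀ x, WittDiff.wittDiffOp p k (n + 1) j r (WittDiff.frobA p k (n + 1) d x) =
        WittDiff.frobA p k (n + 1) d (WittDiff.wittDiffOpDiv p k (n + 1) j r x)) ∧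
      (∀ x, WittDiff.wittDiffOp p k (n + 1) j r (WittDiff.ver n x) =
        WittDiff.ver n (WittDiff.wittDiffOp p k n j r x)) ∧
      (∀ i < n + 1, ∀ x ∈ WittDiff.verFil p n i (MvPolynomial (Fin d) k),
        WittDiff.wittDiffOp p k (n + 1) j r x ∈
          WittDiff.verFil p n i (MvPolynomial (Fin d) k))) ∧
    -- the four relations for multi-indices
    (∀ (n : ℕ) (r : Fin d → ℕ),
      (∀ x, WittDiff.wittDiffOpMultiDiv p k n r (WittDiff.res n x) =
        WittDiff.res n (WittDiff.wittDiffOpMulti p k (n + 1) r x)) ∧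
      (∀ x, WittDiff.wittDiffOpMulti p k (n + 1) r (WittDiff.frobA p k (n + 1) d x) =
        WittDiff.frobA p k (n + 1) d (WittDiff.wittDiffOpMultiDiv p k (n + 1) r x)) ∧
      (∀ x, WittDiff.wittDiffOpMulti p k (n + 1) r (WittDiff.ver n x) =
        WittDiff.ver n (WittDiff.wittDiffOpMulti p k n r x)) ∧
      (∀ i < n + 1, ∀ x ∈ WittDiff.verFil p n i (MvPolynomial (Fin d) k),
        WittDiff.wittDiffOpMulti p k (n + 1) r x ∈
          WittDiff.verFil p n i (MvPolynomial (Fin d) k))) := by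
  refine ⟨fun n j r => ⟨WittDiff.isRestriction_wittDiffOp p k n j r,
    WittDiff.isDiffOp_wittDiffOp p k n j r,
    fun δ hδ => hδ.eq p k (WittDiff.isRestriction_wittDiffOp p k n j r)⟩,
    fun n j r => ⟨WittDiff.wittDiffOpDiv_res p k n j r, WittDiff.wittDiffOp_frobA p k n j r,
      WittDiff.wittDiffOp_ver p k n j r,
      fun i _ x hx => WittDiff.wittDiffOp_mem_verFil p k n j r i hx⟩,
    fun n r => ?_⟩
  simp only [WittDiff.wittDiffOpMulti, WittDiff.wittDiffOpMultiDiv, List.ofFn_eq_map]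
  exact ⟨WittDiff.list_prod_intertwine (f := WittDiff.res n)
      (fun j => WittDiff.wittDiffOpDiv_res p k n j (r j)) _,
    WittDiff.list_prod_intertwine (f := WittDiff.frobA p k (n + 1) d)
      (fun j => WittDiff.wittDiffOp_frobA p k n j (r j)) _,
    WittDiff.list_prod_intertwine (f := WittDiff.ver n)
      (fun j => WittDiff.wittDiffOp_ver p k n j (r j)) _,
    fun i _ x hx => WittDiff.list_prod_mem
      (fun j _ hy => WittDiff.wittDiffOp_mem_verFil p k n j (r j) i hy) _ hx⟩
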